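/- A family $\mathscr F$ of subsets of $\mathbb N_0=\{0,1,2,\dots\}$ is a \emph{Furstenberg family} if $\emptyset\notin\mathscr F\neq\emptyset$ and $E\in\mathscr F$, $E\subset E'\subset\mathbb N_0$ imply $E'\in\mathscr F$. It is a \emph{hypercyclicity set} if, moreover, there are pairwise disjoint sets $A_1,A_2,\dots\in\mathscr F$ such that $|j-j'|\ge\max\{k,k'\}$ whenever $j\in A_k$, $j'\in A_{k'}$ and $j\ne j'$. For $\Gamma\subset\mathbb C$, a bounded linear operator $T$ on a complex Banach space $X$ is \emph{$\mathscr F_\Gamma$-hypercyclic} if there is $x\in X$ such that $\{n\in\mathbb N_0: T^n(\Gamma x)\cap U\ne\emptyset\}\in\mathscr F$ for every non-empty open set $U\subset X$, where $\Gamma x=\{\gamma x:\gamma\in\Gamma\}$. \textbf{Theorem.} Let $\Gamma\subset\mathbb C$ be unbounded, let $\mathscr F$ be a hypercyclicity set, and let $X$ be a separable infinite-dimensional complex Banach space. Then $X$ supports an $\mathscr F_\Gamma$-hypercyclic operator. More precisely, there is a sequence $(x_n,x_n^*)_{n\ge1}\subset X\times X^*$ such that (i) $x_m^*(x_n)=\delta_{mn}$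 for all $m,n$, $\|x_n\|=1$ for all $n$, and $\sup_n\|x_n^*\|<\infty$; (ii) $\operatorname{span}\{x_n:n\ge1\}$ is dense in $X$; (iii) $x=0$ whenever $x_n^*(x)=0$ for all $n$; and for every sequence $(x_n,x_n^*)_{n\ge1}$ with these properties and every summable sequence $\mathbf u=(u_n)_{n\ge1}$ of positive numbers, the formula $$T_{\mathbf u}(x)=\sum_{n=1}^\infty x_{n+1}^*(x)\,u_n\,x_n\qquad(x\in X)$$ defines a bounded linear operator on $X$, and this operator is $\mathscr F_\Gamma$-hypercyclic. -/

import Mathlib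

/-- A Furstenberg family on `ℕ = {0, 1, 2, …}`: non-trivial and hereditarily upward. -/
structure IsFurstenbergFamily (F : Set (Set ℕ)) : Prop where
  empty_notMem : ∅ ∉ F
  nonempty : F.Nonempty
  upward : ∀ A B : Set ℕ, A ⊆ B → A ∈ F → B ∈ F

/-- A hypercyclicity set: a Furstenberg family that contains pairwise disjoint sets `A 1, A 2, …`
whose points are separated as stated (the value `A 0` plays no role). -/
structure IsHypercyclicitySet (F : Set (Set ℕ)) : Prop where
  furstenberg : IsFurstenbergFamily F
  separated : ∃ A : ℕ → Set ℕ,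
    (∀ k, 1 ≤ k → A k ∈ F) ∧
    (∀ k k', 1 ≤ k → 1 ≤ k' → k ≠ k' → Disjoint (A k) (A k')) ∧
    (∀ k k', 1 ≤ k → 1 ≤ k' → ∀ j ∈ A k, ∀ j' ∈ A k', j ≠ j' →
      ((max k k' : ℕ) : ℤ) ≤ |(j : ℤ) - (j' : ℤ)|)

section

variable {X : Type*} [NormedAddCommGroup X] [NormedSpace ℂ X]

/-- The set `{n : T ^ n (Γ x) ∩ U ≠ ∅}`, where `Γ x = {γ x : γ ∈ Γ}`. -/
def returnSet (T : X →L[ℂ] X) (Γ : Set ℂ) (x : X) (U : Set X) : Set ℕ :=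
  {n | ((fun y => (T ^ n) y) '' ((fun γ : ℂ => γ • x) '' Γ) ∩ U).Nonempty}

/-- `x` is an `F_Γ`-hypercyclic vector for `T`. -/
def IsHypercyclicVector (F : Set (Set ℕ)) (Γ : Set ℂ) (T : X →L[ℂ] X) (x : X) : Prop :=
  ∀ U : Set X, IsOpen U → U.Nonempty → returnSet T Γ x U ∈ F

/-- `T` is an `F_Γ`-hypercyclic operator. -/
def IsHypercyclicOperator (F : Set (Set ℕ)) (Γ : Set ℂ) (T : X →L[ℂ] X) : Prop :=
  ∃ x : X, IsHypercyclicVector F Γ T x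

/-- A normalized bounded biorthogonal sequence that is fundamental and total
(indexed from `0` instead of `1`). -/
structure IsBoundedBiorthogonalSystem (x : ℕ → X) (f : ℕ → X →L[ℂ] ℂ) : Prop where
  biorthogonal : ∀ m n, f m (x n) = if m = n then 1 else 0
  norm_eq_one : ∀ n, ‖x n‖ = 1
  bounded : ∃ C : ℝ, ∀ n, ‖f n‖ ≤ C
  dense_span : Dense (Submodule.span ℂ (Set.range x) : Set X)
  total : ∀ v : X, (∀ n, f n v = 0) → v = 0

end

/-! ### Backward shifts and construction of the hypercyclic vector. -/

section Shift

variable {X : Type*} [NormedAddCommGroup X] [NormedSpace ℂ X]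

/-! Let `V k` be the span of the first `k` basis vectors. The weighted backward shift `T` kills `V
k` after `k` steps and maps `V (k + 1)` onto `V k`. Choose `v k` in `V k`, dense in a strong sense,
and for `j` in `A k` pick `w j` with `T ^ j` sending `w j` to `v k`. The hypercyclic vector is the
sum of `(γ j)⁻¹ • w j`, where `γ j` in `Γ` grows very fast. Apply `γ n • T ^ n` with `n` in `A k`:
the term `j = n` gives `v k`; terms with `j < n` vanish, because the gap exceeds the nilpotency
order of their targets; terms with `j > n` are tiny by the growth of `γ`, and the gap `j - n ≥ k`
makes their sum at most of order `2 ^ (-k)`. This is `isHypercyclicOperator_of_backward`.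

The basis comes from the Ovsepian–Pełczyński method. A Gram–Schmidt recursion captures a dense
sequence of vectors and a total sequence of functionals without norm control, and Mazur's lemma
interleaves infinitely many well-bounded pairs (`exists_biorthogonal_odd_bounded`). Each
uncontrolled pair is then mixed with a finite block of bounded ones by an orthogonal matrix
(`exists_orthogonal_small_column`), which preserves biorthogonality and spans while diluting the
large norm. -/

/-- A weighted backward shift along a normalized sequence with bounded functionals and summable
weights is a bounded operator. -/
theorem exists_weightedBackwardShift [CompleteSpace X] {x : ℕ → X} {f : ℕ → X →L[ℂ] ℂ}
    (hx : ∀ n, ‖x n‖ = 1) {C : ℝ} (hf : ∀ n, ‖f n‖ ≤ C) {u : ℕ → ℝ} (hu : ∀ n, 0 < u n)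
    (hs : Summable u) :
    ∃ T : X →L[ℂ] X, ∀ v, HasSum (fun n => (f (n + 1) v * (u n : ℂ)) • x n) (T v) := by
  let g : ℕ → X →L[ℂ] X := fun n => (f (n + 1)).smulRight ((u n : ℂ) • x n)
  have hg : Summable g := by
    refine Summable.of_norm_bounded (hs.mul_left C) fun n => ?_
    rw [ContinuousLinearMap.norm_smulRight_apply, norm_smul, hx, mul_one, Complex.norm_real,
      Real.norm_of_nonneg (hu n).le]
    exact mul_le_mul_of_nonneg_right (hf _) (hu n).le
  refine ⟨∑' n, g n, fun v => ?_⟩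
  have h := hg.hasSum.mapL (ContinuousLinearMap.apply ℂ X v)
  have e : (fun n => (f (n + 1) v * (u n : ℂ)) • x n) =
      fun n => ContinuousLinearMap.apply ℂ X v (g n) := by
    funext n
    rw [mul_smul]
    rfl
  rw [e]
  exact h

/-- An unbounded set of scalars contains sequences growing as fast as prescribed. -/
theorem exists_seq_mem_norm_ge {Γ : Set ℂ} (hΓ : ¬ Bornology.IsBounded Γ) (B : ℕ → ℝ) :
    ∃ γ : ℕ → ℂ, (∀ n, γ n ∈ Γ) ∧ (∀ n, 1 ≤ ‖γ n‖) ∧ (∀ n, B n ≤ ‖γ n‖) ∧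
      ∀ m n, m < n → B n * ‖γ m‖ ≤ ‖γ n‖ := by
  have key : ∀ R : ℝ, ∃ z ∈ Γ, R ≤ ‖z‖ := by
    intro R
    by_contra! h
    exact hΓ (isBounded_iff_forall_norm_le.2 ⟨R, fun z hz => (h z hz).le⟩)
  choose z hz hzR using key
  -- Keeping `b n ≥ 1` makes the norms monotone, so growth over the previous term alone gives growth
  -- over all earlier ones.
  let b : ℕ → ℝ := fun n => 1 + |B n|
  let γ : ℕ → ℂ := fun n => Nat.rec (z (b 0)) (fun n w => z (b (n + 1) * (1 + ‖w‖))) n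
  have hsucc : ∀ n, b (n + 1) * (1 + ‖γ n‖) ≤ ‖γ (n + 1)‖ := fun n => hzR _
  have hb1 : ∀ n, 1 ≤ b n := fun n => by simp [b]
  have hbB : ∀ n, B n ≤ b n := fun n => by
    have := le_abs_self (B n)
    simp only [b]; linarith
  have hbγ : ∀ n, b n ≤ ‖γ n‖ := by
    rintro (_ | n)
    · exact hzR _
    · have := hsucc n
      nlinarith [hb1 (n + 1), norm_nonneg (γ n)]
  have hmono : Monotone fun n => ‖γ n‖ := by
    refine monotone_nat_of_le_succ fun n => ?_
    have := hsucc n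
    nlinarith [hb1 (n + 1), norm_nonneg (γ n)]
  refine ⟨γ, ?_, fun n => (hb1 n).trans (hbγ n), fun n => (hbB n).trans (hbγ n), ?_⟩
  · rintro (_ | n) <;> exact hz _
  · rintro m (_ | n) hmn
    · omega
    · have h1 := hsucc n
      have h2 : ‖γ m‖ ≤ ‖γ n‖ := hmono (by omega)
      have h3 := mul_le_mul_of_nonneg_right (hbB (n + 1)) (norm_nonneg (γ m))
      nlinarith [hb1 (n + 1), norm_nonneg (γ n), norm_nonneg (γ m)]

/-- If the union of an increasing sequence of subspaces is dense, one can choose `v k` in the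
`k`-th subspace such that every open set contains the `2 * 2 ^ (-k)`-closed ball around some
`v k`. -/
theorem exists_seq_mem_closedBall_subset [TopologicalSpace.SeparableSpace X]
    {V : ℕ → Submodule ℂ X} (hV : Monotone V) (hd : Dense (⋃ k, (V k : Set X))) :
    ∃ v : ℕ → X, (∀ k, v k ∈ V k) ∧ ∀ U : Set X, IsOpen U → U.Nonempty →
      ∃ k, 1 ≤ k ∧ Metric.closedBall (v k) (2 * (1 / 2) ^ k) ⊆ U := by
  classical
  have := UniformSpace.secondCountable_of_separable X
  have : Nonempty (⋃ k, (V k : Set X)) := ⟨⟨0, Set.mem_iUnion.2 ⟨0, (V 0).zero_mem⟩⟩⟩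
  let w := TopologicalSpace.denseSeq (⋃ k, (V k : Set X))
  -- Unpairing revisits every dense point infinitely often; `0` stands in while the point is not yet
  -- in `V k`.
  let v : ℕ → X := fun k => if (w k.unpair.1 : X) ∈ V k then (w k.unpair.1 : X) else 0
  refine ⟨v, fun k => ?_, fun U hU hne => ?_⟩
  · simp only [v]
    split_ifs with h
    · exact h
    · exact (V k).zero_mem
  · obtain ⟨p, hpU, hp⟩ := hd.exists_mem_open hU hne |>.imp fun p h => And.symm h
    obtain ⟨i, hi⟩ := (TopologicalSpace.denseRange_denseSeq (⋃ k, (V k : Set X))).exists_mem_open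
      (hU.preimage continuous_subtype_val) ⟨⟨p, hp⟩, hpU⟩
    obtain ⟨ε, hε, hball⟩ := Metric.isOpen_iff.1 hU _ hi
    obtain ⟨N, hN⟩ := Set.mem_iUnion.1 (w i).2
    obtain ⟨M, hM⟩ := exists_pow_lt_of_lt_one (show 0 < ε / 2 by positivity)
      (show (1 / 2 : ℝ) < 1 by norm_num)
    let k := Nat.pair i (N + M + 1)
    have hk : N + M + 1 ≤ k := Nat.right_le_pair _ _
    have hvk : v k = w i := by
      have : (w i : X) ∈ V k := hV (by omega : N ≤ k) hN
      simp [v, k, this]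
    refine ⟨k, by omega, ?_⟩
    rw [hvk]
    refine (Metric.closedBall_subset_ball ?_).trans hball
    have : (1 / 2 : ℝ) ^ k ≤ (1 / 2) ^ M :=
      pow_le_pow_of_le_one (by norm_num) (by norm_num) (by omega)
    linarith

/-- An operator that is nilpotent on each member, and maps each member of an increasing sequence of
subspaces with dense union onto the preceding one, is `F_Γ`-hypercyclic. -/
theorem isHypercyclicOperator_of_backward [CompleteSpace X] [TopologicalSpace.SeparableSpace X]
    {Γ : Set ℂ} (hΓ : ¬ Bornology.IsBounded Γ) {F : Set (Set ℕ)} (hF : IsHypercyclicitySet F)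
    {T : X →L[ℂ] X} {V : ℕ → Submodule ℂ X} (hV : Monotone V)
    (hd : Dense (⋃ k, (V k : Set X))) (hker : ∀ k, ∀ v ∈ V k, (T ^ k) v = 0)
    (hsurj : ∀ k, ∀ v ∈ V k, ∃ w ∈ V (k + 1), T w = v) :
    IsHypercyclicOperator F Γ T := by
  classical
  obtain ⟨A, hAF, hAdisj, hAsep⟩ := hF.separated
  obtain ⟨v, hvV, hvU⟩ := exists_seq_mem_closedBall_subset hV hd
  have hpre : ∀ j k, ∃ w, (T ^ j) w = v k := by
    have : ∀ j k, ∀ y ∈ V k, ∃ w, (T ^ j) w = y := by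
      intro j
      induction j with
      | zero => exact fun k y _ => ⟨y, by simp⟩
      | succ j ih =>
        intro k y hy
        obtain ⟨y', hy', rfl⟩ := hsurj k y hy
        obtain ⟨w, rfl⟩ := ih _ y' hy'
        exact ⟨w, by rw [pow_succ']; rfl⟩
    exact fun j k => this j k _ (hvV k)
  have hidx : ∃ κ : ℕ → ℕ, ∀ k, 1 ≤ k → ∀ j ∈ A k, κ j = k := by
    have : ∀ j, ∃ k, ∀ k', 1 ≤ k' → j ∈ A k' → k = k' := by
      intro j
      by_cases h : ∃ k, 1 ≤ k ∧ j ∈ A k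
      · obtain ⟨k, hk, hj⟩ := h
        refine ⟨k, fun k' hk' hj' => ?_⟩
        by_contra hne
        exact Set.disjoint_left.1 (hAdisj k k' hk hk' hne) hj hj'
      · exact ⟨0, fun k' hk' hj' => (h ⟨k', hk', hj'⟩).elim⟩
    choose κ hκ using this
    exact ⟨κ, fun k hk j hj => hκ j k hk hj⟩
  obtain ⟨κ, hκ⟩ := hidx
  choose w hw using fun j => hpre j (κ j)
  -- The sum covers every power `n ≤ j` at once: `n = 0` gives summability of the series, `0 < n <
  -- j` controls its tails after `T ^ n`.
  let B : ℕ → ℝ := fun j => 4 ^ j * ∑ n ∈ Finset.range (j + 1), ‖(T ^ n) (w j)‖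
  have hB : ∀ n j, n ≤ j → 4 ^ j * ‖(T ^ n) (w j)‖ ≤ B j := fun n j hnj => by
    refine mul_le_mul_of_nonneg_left ?_ (by positivity)
    exact Finset.single_le_sum (f := fun n => ‖(T ^ n) (w j)‖) (fun _ _ => norm_nonneg _)
      (Finset.mem_range.2 (by omega))
  obtain ⟨γ, hγΓ, hγ1, hγB, hγm⟩ := exists_seq_mem_norm_ge hΓ B
  have hγ0 : ∀ n, γ n ≠ 0 := fun n h => by
    have := hγ1 n
    rw [h, norm_zero] at this
    linarith
  have hγpos : ∀ n, 0 < ‖γ n‖ := fun n => norm_pos_iff.2 (hγ0 n)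
  let c : ℕ → X := fun j => if ∃ k, 1 ≤ k ∧ j ∈ A k then (γ j)⁻¹ • w j else 0
  have hc : Summable c := by
    refine Summable.of_norm_bounded (g := fun j => (1 / 4 : ℝ) ^ j)
      (summable_geometric_of_lt_one (by norm_num) (by norm_num)) fun j => ?_
    simp only [c]
    split_ifs
    · rw [norm_smul, norm_inv, inv_mul_le_iff₀ (hγpos j), one_div, inv_pow, ← div_eq_mul_inv,
        le_div_iff₀ (by positivity), mul_comm]
      have := hB 0 j (Nat.zero_le _)
      exact (by simpa using this : 4 ^ j * ‖w j‖ ≤ B j).trans (hγB j)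
    · simp
  have hc_of_mem : ∀ k, 1 ≤ k → ∀ j ∈ A k, c j = (γ j)⁻¹ • w j := fun k hk j hj =>
    if_pos ⟨k, hk, hj⟩
  have hclose : ∀ k, 1 ≤ k → ∀ n ∈ A k, ‖(T ^ n) (γ n • ∑' j, c j) - v k‖ ≤ 2 * (1 / 2) ^ k := by
    intro k hk n hn
    let t : ℕ → X := fun j => (T ^ n) (γ n • c j)
    have ht : HasSum t ((T ^ n) (γ n • ∑' j, c j)) :=
      (hc.hasSum.const_smul (γ n)).mapL (T ^ n)
    have htn : t n = v k := by
      simp only [t]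
      rw [hc_of_mem k hk n hn, smul_inv_smul₀ (hγ0 n), hw, hκ k hk n hn]
    have ht' := ht.sub (hasSum_ite_eq n (v k))
    have hgeom : HasSum (fun j : ℕ => (1 / 2 : ℝ) ^ j * (1 / 2) ^ k) (2 * (1 / 2) ^ k) :=
      hasSum_geometric_two.mul_right _
    rw [← ht'.tsum_eq]
    refine tsum_of_norm_bounded hgeom fun j => ?_
    by_cases hjn : j = n
    · subst hjn
      simp only [htn, if_true, sub_self, norm_zero]
      positivity
    rw [if_neg hjn, sub_zero]
    by_cases hj : ∃ k', 1 ≤ k' ∧ j ∈ A k'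
    swap
    · have : c j = 0 := if_neg hj
      simp only [t, this, smul_zero, map_zero, norm_zero]
      positivity
    obtain ⟨k', hk', hj⟩ := hj
    have hsep := hAsep k k' hk hk' n hn j hj (Ne.symm hjn)
    have htj : t j = (γ n * (γ j)⁻¹) • (T ^ n) (w j) := by
      simp only [t]
      rw [hc_of_mem k' hk' j hj, smul_smul, map_smul]
    -- The two halves of the `max` in the separation serve different cases: `k'` for `j < n`, where
    -- `T ^ (n - j)` annihilates `v k'`, and `k` for `j > n`, where `j ≥ k` turns half of the decay
    -- `4 ^ (-j)` into `2 ^ (-k)`.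
    rcases lt_or_gt_of_ne hjn with hlt | hgt
    · have hle : k' ≤ n - j := by
        rw [abs_of_pos (by omega)] at hsep
        have := le_max_right k k'
        omega
      have hzero : (T ^ n) (w j) = 0 := by
        have e : n = (n - j - k') + k' + j := by omega
        rw [e, pow_add, pow_add]
        simp only [mul_apply_eq_comp]
        rw [hw, hκ k' hk' j hj, hker _ _ (hvV k'), map_zero]
      rw [htj, hzero, smul_zero, norm_zero]
      positivity
    · have hle : k ≤ j := by
        rw [abs_of_neg (by omega)] at hsep
        have := le_max_left k k'
        omega
      have h1 : ‖t j‖ ≤ (1 / 4) ^ j := by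
        rw [htj, norm_smul, norm_mul, norm_inv, one_div, inv_pow, mul_right_comm,
          ← div_eq_mul_inv, div_le_iff₀ (hγpos j), inv_mul_eq_div, le_div_iff₀ (by positivity)]
        calc ‖γ n‖ * ‖(T ^ n) (w j)‖ * 4 ^ j = 4 ^ j * ‖(T ^ n) (w j)‖ * ‖γ n‖ := by ring
          _ ≤ B j * ‖γ n‖ := mul_le_mul_of_nonneg_right (hB n j hgt.le) (norm_nonneg _)
          _ ≤ ‖γ j‖ := hγm n j hgt
      refine h1.trans ?_
      calc (1 / 4 : ℝ) ^ j = (1 / 2) ^ j * (1 / 2) ^ j := by rw [← mul_pow]; norm_num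
        _ ≤ (1 / 2) ^ j * (1 / 2) ^ k := by
          refine mul_le_mul_of_nonneg_left ?_ (by positivity)
          exact pow_le_pow_of_le_one (by norm_num) (by norm_num) hle
  refine ⟨∑' j, c j, fun U hU hne => ?_⟩
  obtain ⟨k, hk, hkU⟩ := hvU U hU hne
  refine hF.furstenberg.upward (A k) _ (fun n hn => ?_) (hAF k hk)
  refine ⟨(T ^ n) (γ n • ∑' j, c j), ⟨_, ⟨γ n, hγΓ n, rfl⟩, rfl⟩, hkU ?_⟩
  rw [mem_closedBall_iff_norm]
  exact hclose k hk n hn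

/-- Weighted backward shifts with non-zero weights along a fundamental biorthogonal sequence are
`F_Γ`-hypercyclic. -/
theorem isHypercyclicOperator_weightedBackwardShift [CompleteSpace X]
    [TopologicalSpace.SeparableSpace X]
    {Γ : Set ℂ} (hΓ : ¬ Bornology.IsBounded Γ) {F : Set (Set ℕ)} (hF : IsHypercyclicitySet F)
    {x : ℕ → X} {f : ℕ → X →L[ℂ] ℂ} (hbi : ∀ m n, f m (x n) = if m = n then 1 else 0)
    (hd : Dense (Submodule.span ℂ (Set.range x) : Set X)) {u : ℕ → ℝ} (hu : ∀ n, 0 < u n)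
    {T : X →L[ℂ] X} (hT : ∀ v, HasSum (fun n => (f (n + 1) v * (u n : ℂ)) • x n) (T v)) :
    IsHypercyclicOperator F Γ T := by
  have hT0 : T (x 0) = 0 := by
    refine (hT (x 0)).unique ?_
    simp [hbi]
  have hTs : ∀ n, T (x (n + 1)) = (u n : ℂ) • x n := by
    intro n
    refine (hT (x (n + 1))).unique ?_
    have h := hasSum_single (f := fun m => (f (m + 1) (x (n + 1)) * (u m : ℂ)) • x m) n
      (fun m hm => by simp [hbi, hm])
    simpa [hbi] using h
  let V : ℕ → Submodule ℂ X := fun k => Submodule.span ℂ (x '' Set.Iio k)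
  have hV : Monotone V := fun k l hkl =>
    Submodule.span_mono (Set.image_mono (Set.Iio_subset_Iio hkl))
  refine isHypercyclicOperator_of_backward hΓ hF hV ?_ ?_ ?_
  · refine hd.mono fun y hy => ?_
    rw [← Submodule.coe_iSup_of_directed V hV.directed_le]
    refine (Submodule.span_le.2 ?_ : Submodule.span ℂ (Set.range x) ≤ ⨆ k, V k) hy
    rintro _ ⟨n, rfl⟩
    exact Submodule.mem_iSup_of_mem (n + 1) (Submodule.subset_span ⟨n, Nat.lt_succ_self n, rfl⟩)
  · have hz : ∀ k n, n < k → (T ^ k) (x n) = 0 := by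
      intro k
      induction k with
      | zero => intro n hn; omega
      | succ k ih =>
        intro n hn
        rw [pow_succ, mul_apply_eq_comp]
        cases n with
        | zero => rw [hT0, map_zero]
        | succ n => rw [hTs, map_smul, ih n (by omega), smul_zero]
    intro k y hy
    have : V k ≤ LinearMap.ker ((T ^ k : X →L[ℂ] X) : X →ₗ[ℂ] X) := by
      refine Submodule.span_le.2 ?_
      rintro _ ⟨n, hn, rfl⟩
      exact hz k n hn
    exact this hy
  · intro k y hy
    have : V k ≤ (V (k + 1)).map (T : X →ₗ[ℂ] X) := by
      refine Submodule.span_le.2 ?_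
      rintro _ ⟨n, hn, rfl⟩
      have hun : (u n : ℂ) ≠ 0 := Complex.ofReal_ne_zero.2 (hu n).ne'
      refine ⟨(u n : ℂ)⁻¹ • x (n + 1), (V (k + 1)).smul_mem _ (Submodule.subset_span
        ⟨n + 1, Nat.succ_lt_succ hn, rfl⟩), ?_⟩
      rw [ContinuousLinearMap.coe_coe, map_smul, hTs, inv_smul_smul₀ hun]
    exact this hy

end Shift

/-! ### Hahn–Banach and Mazur's lemma. -/

section Markushevich

variable {X : Type*} [NormedAddCommGroup X] [NormedSpace ℂ X]

/-- Hahn-Banach: a point at distance at least `δ` from a closed subspace is separated from it by a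
functional of norm at most `1 / δ`. -/
theorem exists_dual_eq_one_of_le_norm_sub (E : Submodule ℂ X) (hE : IsClosed (E : Set X)) {x : X}
    {δ : ℝ} (hδ : 0 < δ) (h : ∀ e ∈ E, δ ≤ ‖x - e‖) :
    ∃ f : X →L[ℂ] ℂ, (∀ e ∈ E, f e = 0) ∧ f x = 1 ∧ ‖f‖ ≤ 1 / δ := by
  have := hE
  have hq : δ ≤ ‖E.mkQL x‖ := by
    have : ‖E.mkQL x‖ = Metric.infDist x (E : Set X) :=
      QuotientAddGroup.norm_mk (S := E.toAddSubgroup) x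
    rw [this]
    refine (Metric.le_infDist ⟨0, E.zero_mem⟩).2 fun e he => ?_
    rw [dist_eq_norm]
    exact h e he
  have hpos : 0 < ‖E.mkQL x‖ := hδ.trans_le hq
  obtain ⟨g, hg, hgx⟩ := exists_dual_vector ℂ (E.mkQL x) hpos.ne'
  refine ⟨((‖E.mkQL x‖ : ℂ)⁻¹) • g.comp E.mkQL, fun e he => ?_, ?_, ?_⟩
  · have : E.mkQL e = 0 := (Submodule.Quotient.mk_eq_zero E).2 he
    simp [this]
  · have : (‖E.mkQL x‖ : ℂ) ≠ 0 := Complex.ofReal_ne_zero.2 hpos.ne'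
    simp only [smul_apply, ContinuousLinearMap.comp_apply, hgx, smul_eq_mul]
    exact inv_mul_cancel₀ this
  · refine ContinuousLinearMap.opNorm_le_bound _ (by positivity) fun y => ?_
    have h1 : ‖g (E.mkQL y)‖ ≤ ‖y‖ := by
      refine (g.le_opNorm _).trans ?_
      rw [hg, one_mul]
      exact Submodule.Quotient.norm_mk_le E y
    have h2 : ‖E.mkQL x‖⁻¹ ≤ 1 / δ := by
      rw [one_div]
      exact inv_anti₀ hδ hq
    simp only [smul_apply, ContinuousLinearMap.comp_apply, norm_smul, norm_inv,
      Complex.norm_real, norm_norm]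
    exact mul_le_mul h2 h1 (norm_nonneg _) (by positivity)

theorem exists_norm_eq_one_forall_apply_eq_zero (hX : ¬ FiniteDimensional ℂ X)
    (Φ : Finset (X →L[ℂ] ℂ)) : ∃ x : X, ‖x‖ = 1 ∧ ∀ φ ∈ Φ, φ x = 0 := by
  let L : X →ₗ[ℂ] (Φ → ℂ) := LinearMap.pi fun φ => (φ.1 : X →ₗ[ℂ] ℂ)
  have hL : ¬ Function.Injective L := fun h => hX (FiniteDimensional.of_injective L h)
  rw [← LinearMap.ker_eq_bot] at hL
  obtain ⟨y, hy, hy0⟩ := (Submodule.ne_bot_iff _).1 hL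
  have hyn : ‖y‖ ≠ 0 := norm_ne_zero_iff.2 hy0
  refine ⟨(‖y‖ : ℂ)⁻¹ • y, ?_, fun φ hφ => ?_⟩
  · rw [norm_smul, norm_inv, Complex.norm_real, norm_norm, inv_mul_cancel₀ hyn]
  · have : φ y = 0 := congrFun hy ⟨φ, hφ⟩
    rw [map_smul, this, smul_zero]

/-- A finite set of functionals of norm at most one that is `1 / 2`-norming for a
finite-dimensional subspace. -/
theorem exists_finset_half_norming (E : Submodule ℂ X) [FiniteDimensional ℂ E] :
    ∃ Φ : Finset (X →L[ℂ] ℂ), (∀ φ ∈ Φ, ‖φ‖ ≤ 1) ∧ ∀ e ∈ E, e ≠ 0 → ∃ φ ∈ Φ, ‖e‖ / 2 ≤ ‖φ e‖ := by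
  classical
  choose g hg1 hg using fun e : X => exists_dual_vector'' ℂ e
  have hK : IsCompact (Metric.sphere (0 : E) 1) := by
    have := FiniteDimensional.proper ℂ E
    exact isCompact_sphere 0 1
  -- Each unit vector lies in the open set where its own norming functional exceeds `1 / 2`.
  obtain ⟨t, ht⟩ := hK.elim_finite_subcover (fun e : E => {y : E | 1 / 2 < ‖g e y‖})
    (fun e => isOpen_lt continuous_const (by fun_prop)) (fun e he => by
      refine Set.mem_iUnion.2 ⟨e, ?_⟩
      have : ‖(e : X)‖ = 1 := by simpa using he
      simp only [Set.mem_ofPred_eq, hg, this]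
      norm_num)
  refine ⟨t.image fun e : E => g (e : X), fun φ hφ => ?_, fun e he he0 => ?_⟩
  · obtain ⟨e, -, rfl⟩ := Finset.mem_image.1 hφ
    exact hg1 _
  · have hpos : 0 < ‖e‖ := norm_pos_iff.2 he0
    let e' : E := (‖e‖ : ℂ)⁻¹ • ⟨e, he⟩
    have he' : e' ∈ Metric.sphere (0 : E) 1 := by
      simp only [e', mem_sphere_iff_norm, sub_zero, norm_smul, norm_inv, Complex.norm_real,
        norm_norm]
      exact inv_mul_cancel₀ hpos.ne'
    obtain ⟨i, hi, hie⟩ := Set.mem_iUnion₂.1 (ht he')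
    refine ⟨g i, Finset.mem_image_of_mem _ hi, ?_⟩
    have h1 : 1 / 2 < ‖e‖⁻¹ * ‖g i e‖ := by
      have h2 : g i (e' : X) = (‖e‖ : ℂ)⁻¹ * g i e := by
        simp [e']
      have h3 : 1 / 2 < ‖g i (e' : X)‖ := hie
      rwa [h2, norm_mul, norm_inv, Complex.norm_real, norm_norm] at h3
    rw [inv_mul_eq_div, lt_div_iff₀ hpos] at h1
    linarith

/-- Mazur's lemma: given finitely many functionals and a finite-dimensional subspace `E`, there
are a unit vector annihilated by the functionals and a functional of norm at most `3` which
annihilates `E` and takes the value `1` at that vector. -/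
theorem exists_norm_eq_one_dual_norm_le_three (hX : ¬ FiniteDimensional ℂ X)
    (E : Submodule ℂ X) [FiniteDimensional ℂ E] (Φ : Finset (X →L[ℂ] ℂ)) :
    ∃ (x : X) (f : X →L[ℂ] ℂ), ‖x‖ = 1 ∧ ‖f‖ ≤ 3 ∧ f x = 1 ∧ (∀ φ ∈ Φ, φ x = 0) ∧
      ∀ e ∈ E, f e = 0 := by
  classical
  obtain ⟨Ψ, hΨ1, hΨ⟩ := exists_finset_half_norming E
  obtain ⟨x, hx1, hx⟩ := exists_norm_eq_one_forall_apply_eq_zero hX (Φ ∪ Ψ)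
  -- A half-norming functional kills `x`, so `‖e‖ ≤ 2 * ‖x - e‖`; with `1 ≤ ‖x - e‖ + ‖e‖` this
  -- gives `1 / 3`.
  have hdist : ∀ e ∈ E, (1 / 3 : ℝ) ≤ ‖x - e‖ := by
    intro e he
    have h1 : 1 - ‖x - e‖ ≤ ‖e‖ := by
      have := norm_sub_norm_le x (x - e)
      rw [sub_sub_cancel, hx1] at this
      exact this
    by_cases he0 : e = 0
    · simp [he0, hx1]; norm_num
    · obtain ⟨φ, hφ, hφe⟩ := hΨ e he he0
      have h2 : ‖φ e‖ ≤ ‖x - e‖ := by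
        have h3 : φ (x - e) = - φ e := by
          rw [map_sub, hx φ (Finset.mem_union_right _ hφ), zero_sub]
        calc ‖φ e‖ = ‖φ (x - e)‖ := by rw [h3, norm_neg]
          _ ≤ ‖φ‖ * ‖x - e‖ := φ.le_opNorm _
          _ ≤ 1 * ‖x - e‖ := mul_le_mul_of_nonneg_right (hΨ1 φ hφ) (norm_nonneg _)
          _ = ‖x - e‖ := one_mul _
      linarith
  obtain ⟨f, hf0, hf1, hf⟩ := exists_dual_eq_one_of_le_norm_sub E E.closed_of_finiteDimensional
    (by norm_num : (0 : ℝ) < 1 / 3) hdist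
  exact ⟨x, f, hx1, hf.trans (by norm_num), hf1,
    fun φ hφ => hx φ (Finset.mem_union_left _ hφ), hf0⟩

/-! ### Recursive construction of a biorthogonal sequence. -/

/-- The pair `a` extends the biorthogonal family formed by the first `n` pairs of `s`. -/
def ExtendsBiorthogonal (n : ℕ) (s : ℕ → X × (X →L[ℂ] ℂ)) (a : X × (X →L[ℂ] ℂ)) : Prop :=
  a.2 a.1 = 1 ∧ ∀ i < n, a.2 (s i).1 = 0 ∧ (s i).2 a.1 = 0

theorem apply_eq_ite_of_extendsBiorthogonal {n : ℕ} {s : ℕ → X × (X →L[ℂ] ℂ)}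
    (hs : ∀ m < n, ExtendsBiorthogonal m s (s m)) {i j : ℕ} (hi : i < n) (hj : j < n) :
    (s i).2 (s j).1 = if i = j then 1 else 0 := by
  rcases lt_trichotomy i j with h | h | h
  · rw [if_neg h.ne, ((hs j hj).2 i h).2]
  · subst h
    rw [if_pos rfl, (hs i hi).1]
  · rw [if_neg h.ne', ((hs i hi).2 j h).1]

theorem exists_extendsBiorthogonal_norm_le (hX : ¬ FiniteDimensional ℂ X) (n : ℕ)
    (s : ℕ → X × (X →L[ℂ] ℂ)) :
    ∃ a, ExtendsBiorthogonal n s a ∧ ‖a.1‖ = 1 ∧ ‖a.2‖ ≤ 3 := by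
  classical
  have : FiniteDimensional ℂ (Submodule.span ℂ ((fun i => (s i).1) '' Set.Iio n)) :=
    FiniteDimensional.span_of_finite ℂ ((Set.finite_Iio n).image _)
  obtain ⟨x, f, hx, hf, hfx, hΦ, hE⟩ := exists_norm_eq_one_dual_norm_le_three hX
    (Submodule.span ℂ ((fun i => (s i).1) '' Set.Iio n))
    ((Finset.range n).image fun i => (s i).2)
  refine ⟨(x, f), ⟨hfx, fun i hi => ⟨hE _ (Submodule.subset_span ⟨i, hi, rfl⟩), ?_⟩⟩, hx, hf⟩
  exact hΦ _ (Finset.mem_image_of_mem _ (Finset.mem_range.2 hi))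

/-- Gram–Schmidt: the remainder of `d` after projection is the new vector, and Hahn–Banach supplies
its functional. No norm bound is available, since the remainder may be close to the old span. -/
theorem exists_extendsBiorthogonal_mem_span_fst (hX : ¬ FiniteDimensional ℂ X) {n : ℕ}
    {s : ℕ → X × (X →L[ℂ] ℂ)} (hs : ∀ m < n, ExtendsBiorthogonal m s (s m)) (d : X) :
    ∃ a, ExtendsBiorthogonal n s a ∧
      d ∈ Submodule.span ℂ (insert a.1 ((fun i => (s i).1) '' Set.Iio n)) := by
  let S : Set X := (fun i => (s i).1) '' Set.Iio n
  let d' : X := d - ∑ i ∈ Finset.range n, (s i).2 d • (s i).1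
  have hsum : ∑ i ∈ Finset.range n, (s i).2 d • (s i).1 ∈ Submodule.span ℂ S :=
    Submodule.sum_mem _ fun i hi => Submodule.smul_mem _ _
      (Submodule.subset_span ⟨i, Finset.mem_range.1 hi, rfl⟩)
  have hd' : ∀ i < n, (s i).2 d' = 0 := by
    intro i hi
    simp only [d', map_sub, map_sum, map_smul, smul_eq_mul]
    rw [Finset.sum_congr rfl fun j hj => by
      rw [apply_eq_ite_of_extendsBiorthogonal hs hi (Finset.mem_range.1 hj)]]
    simp [hi]
  by_cases hmem : d' ∈ Submodule.span ℂ S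
  · obtain ⟨a, ha, -⟩ := exists_extendsBiorthogonal_norm_le hX n s
    refine ⟨a, ha, Submodule.span_mono (Set.subset_insert _ _) ?_⟩
    have : d = d' + ∑ i ∈ Finset.range n, (s i).2 d • (s i).1 := by simp [d']
    rw [this]
    exact Submodule.add_mem _ hmem hsum
  · have : FiniteDimensional ℂ (Submodule.span ℂ S) :=
      FiniteDimensional.span_of_finite ℂ ((Set.finite_Iio n).image _)
    have hcl := (Submodule.span ℂ S).closed_of_finiteDimensional
    have hpos := (hcl.notMem_iff_infDist_pos ⟨0, Submodule.zero_mem _⟩).1 hmem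
    obtain ⟨f, hf0, hf1, -⟩ := exists_dual_eq_one_of_le_norm_sub _ hcl hpos (x := d')
      fun e he => by
        rw [← dist_eq_norm]
        exact Metric.infDist_le_dist_of_mem he
    refine ⟨(d', f), ⟨hf1, fun i hi => ⟨hf0 _ (Submodule.subset_span ⟨i, hi, rfl⟩), hd' i hi⟩⟩, ?_⟩
    have : d = d' + ∑ i ∈ Finset.range n, (s i).2 d • (s i).1 := by simp [d']
    rw [this]
    exact Submodule.add_mem _ (Submodule.subset_span (Set.mem_insert _ _))
      (Submodule.span_mono (Set.subset_insert _ _) hsum)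

/-- The dual step: the remainder of `g` is the new functional, and a point where it is non-zero,
corrected by projection, is the new vector. -/
theorem exists_extendsBiorthogonal_mem_span_snd (hX : ¬ FiniteDimensional ℂ X) {n : ℕ}
    {s : ℕ → X × (X →L[ℂ] ℂ)} (hs : ∀ m < n, ExtendsBiorthogonal m s (s m)) (g : X →L[ℂ] ℂ) :
    ∃ a, ExtendsBiorthogonal n s a ∧
      g ∈ Submodule.span ℂ (insert a.2 ((fun i => (s i).2) '' Set.Iio n)) := by
  let S : Set (X →L[ℂ] ℂ) := (fun i => (s i).2) '' Set.Iio n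
  let g' : X →L[ℂ] ℂ := g - ∑ i ∈ Finset.range n, g (s i).1 • (s i).2
  have hg : g = g' + ∑ i ∈ Finset.range n, g (s i).1 • (s i).2 := by simp [g']
  have hsum : ∑ i ∈ Finset.range n, g (s i).1 • (s i).2 ∈ Submodule.span ℂ S :=
    Submodule.sum_mem _ fun i hi => Submodule.smul_mem _ _
      (Submodule.subset_span ⟨i, Finset.mem_range.1 hi, rfl⟩)
  have hg' : ∀ i < n, g' (s i).1 = 0 := by
    intro i hi
    simp only [g', sub_apply, sum_apply,
      smul_apply, smul_eq_mul]
    rw [Finset.sum_congr rfl fun j hj => by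
      rw [apply_eq_ite_of_extendsBiorthogonal hs (Finset.mem_range.1 hj) hi]]
    simp [hi]
  by_cases h0 : g' = 0
  · obtain ⟨a, ha, -⟩ := exists_extendsBiorthogonal_norm_le hX n s
    refine ⟨a, ha, Submodule.span_mono (Set.subset_insert _ _) ?_⟩
    rw [hg, h0, zero_add]
    exact hsum
  · obtain ⟨y, hy⟩ : ∃ y, g' y ≠ 0 := by
      by_contra! h
      exact h0 (ContinuousLinearMap.ext h)
    let y' : X := (g' y)⁻¹ • (y - ∑ j ∈ Finset.range n, (s j).2 y • (s j).1)
    refine ⟨(y', g'), ⟨?_, fun i hi => ⟨hg' i hi, ?_⟩⟩, ?_⟩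
    · have : ∑ j ∈ Finset.range n, (s j).2 y * g' (s j).1 = 0 :=
        Finset.sum_eq_zero fun j hj => by rw [hg' j (Finset.mem_range.1 hj), mul_zero]
      simp only [y', map_smul, map_sub, map_sum, smul_eq_mul, this, sub_zero]
      exact inv_mul_cancel₀ hy
    · simp only [y', map_smul, map_sub, map_sum, smul_eq_mul]
      rw [Finset.sum_congr rfl fun j hj => by
        rw [apply_eq_ite_of_extendsBiorthogonal hs hi (Finset.mem_range.1 hj)]]
      simp [hi]
    · rw [hg]
      exact Submodule.add_mem _ (Submodule.subset_span (Set.mem_insert _ _))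
        (Submodule.span_mono (Set.subset_insert _ _) hsum)

/-- The sequence whose `n`-th term is computed by `F` from the preceding terms. -/
noncomputable def seqOfEarlierTerms {α : Type*} [Inhabited α] (F : ℕ → (ℕ → α) → α) (n : ℕ) : α :=
  F n fun i => if _h : i < n then seqOfEarlierTerms F i else default
termination_by n

/-- Recursive construction of a sequence each term of which is related to the preceding ones. -/
theorem exists_seq_of_forall_earlierTerms {α : Type*} [Inhabited α] (R : ℕ → (ℕ → α) → α → Prop)
    (hR : ∀ n s t a, (∀ i < n, s i = t i) → R n s a → R n t a)
    (h : ∀ n s, (∀ m < n, R m s (s m)) → ∃ a, R n s a) : ∃ s : ℕ → α, ∀ n, R n s (s n) := by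
  classical
  let F : ℕ → (ℕ → α) → α := fun n s => if h : ∃ a, R n s a then h.choose else default
  let s := seqOfEarlierTerms F
  refine ⟨s, fun n => ?_⟩
  induction n using Nat.strong_induction_on with
  | _ n ih =>
    -- Only the truncated history enters the choice; `hR` transfers `R` between it and `s`.
    let p : ℕ → α := fun i => if i < n then s i else default
    have hp : ∀ i < n, p i = s i := fun i hi => if_pos hi
    have hsn : s n = F n p := by
      simp only [s, p]
      rw [seqOfEarlierTerms]
      simp
    have hex : ∃ a, R n p a := h n p fun m hm => by
      rw [hp m hm]
      exact hR m s p _ (fun i hi => (hp i (hi.trans hm)).symm) (ih m hm)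
    have hRn : R n p (F n p) := by
      simp only [F, dif_pos hex]
      exact hex.choose_spec
    rw [hsn]
    exact hR n p s _ hp hRn

/-- Countably many functionals separate the points of a separable space. -/
theorem exists_seq_dual_total [TopologicalSpace.SeparableSpace X] :
    ∃ g : ℕ → X →L[ℂ] ℂ, ∀ v, (∀ n, g n v = 0) → v = 0 := by
  choose φ hφ1 hφ using fun e : X => exists_dual_vector'' ℂ e
  let d := TopologicalSpace.denseSeq X
  refine ⟨fun n => φ (d n), fun v hv => ?_⟩
  by_contra hv0
  have hpos : 0 < ‖v‖ := norm_pos_iff.2 hv0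
  obtain ⟨n, hn⟩ := (TopologicalSpace.denseRange_denseSeq X).exists_dist_lt v
    (show 0 < ‖v‖ / 2 by positivity)
  rw [dist_eq_norm] at hn
  have h1 : ‖d n‖ ≤ ‖v - d n‖ := by
    have h2 : φ (d n) (v - d n) = -(‖d n‖ : ℂ) := by rw [map_sub, hv n, hφ, zero_sub]; rfl
    calc ‖d n‖ = ‖φ (d n) (v - d n)‖ := by rw [h2, norm_neg, Complex.norm_real, norm_norm]
      _ ≤ ‖φ (d n)‖ * ‖v - d n‖ := (φ (d n)).le_opNorm _
      _ ≤ 1 * ‖v - d n‖ := mul_le_mul_of_nonneg_right (hφ1 _) (norm_nonneg _)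
      _ = _ := one_mul _
  have h3 := norm_sub_norm_le v (d n)
  change ‖v - d n‖ < _ at hn
  linarith

/-- A fundamental total biorthogonal sequence whose terms of odd index are uniformly bounded. -/
theorem exists_biorthogonal_odd_bounded [TopologicalSpace.SeparableSpace X]
    (hX : ¬ FiniteDimensional ℂ X) :
    ∃ (x : ℕ → X) (f : ℕ → X →L[ℂ] ℂ), (∀ m n, f m (x n) = if m = n then 1 else 0) ∧
      Dense (Submodule.span ℂ (Set.range x) : Set X) ∧ (∀ v, (∀ n, f n v = 0) → v = 0) ∧
      ∀ n, ‖x (2 * n + 1)‖ = 1 ∧ ‖f (2 * n + 1)‖ ≤ 3 := by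
  obtain ⟨g, hg⟩ := exists_seq_dual_total (X := X)
  let d := TopologicalSpace.denseSeq X
  have : Inhabited (X × (X →L[ℂ] ℂ)) := ⟨0⟩
  let R : ℕ → (ℕ → X × (X →L[ℂ] ℂ)) → X × (X →L[ℂ] ℂ) → Prop := fun n s a =>
    ExtendsBiorthogonal n s a ∧ (n % 2 = 1 → ‖a.1‖ = 1 ∧ ‖a.2‖ ≤ 3) ∧
    (n % 4 = 0 → d (n / 4) ∈ Submodule.span ℂ (insert a.1 ((fun i => (s i).1) '' Set.Iio n))) ∧
    (n % 4 = 2 → g (n / 4) ∈ Submodule.span ℂ (insert a.2 ((fun i => (s i).2) '' Set.Iio n)))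
  obtain ⟨s, hs⟩ := exists_seq_of_forall_earlierTerms R
    (by
      rintro n s t a hst ⟨h1, h2, h3, h4⟩
      have e1 : (fun i => (s i).1) '' Set.Iio n = (fun i => (t i).1) '' Set.Iio n :=
        Set.image_congr fun i hi => by rw [hst i hi]
      have e2 : (fun i => (s i).2) '' Set.Iio n = (fun i => (t i).2) '' Set.Iio n :=
        Set.image_congr fun i hi => by rw [hst i hi]
      exact ⟨⟨h1.1, fun i hi => by rw [← hst i hi]; exact h1.2 i hi⟩, h2, e1 ▸ h3, e2 ▸ h4⟩)
    (by
      intro n s hs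
      have hs' : ∀ m < n, ExtendsBiorthogonal m s (s m) := fun m hm => (hs m hm).1
      by_cases h0 : n % 4 = 0
      · obtain ⟨a, ha, had⟩ := exists_extendsBiorthogonal_mem_span_fst hX hs' (d (n / 4))
        exact ⟨a, ha, fun h => by omega, fun _ => had, fun h => by omega⟩
      by_cases h2 : n % 4 = 2
      · obtain ⟨a, ha, hag⟩ := exists_extendsBiorthogonal_mem_span_snd hX hs' (g (n / 4))
        exact ⟨a, ha, fun h => by omega, fun h => by omega, fun _ => hag⟩
      · obtain ⟨a, ha, hab⟩ := exists_extendsBiorthogonal_norm_le hX n s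
        exact ⟨a, ha, fun _ => hab, fun h => by omega, fun h => by omega⟩)
  refine ⟨fun n => (s n).1, fun n => (s n).2, fun m n => ?_, ?_, fun v hv => ?_, fun n => ?_⟩
  · exact apply_eq_ite_of_extendsBiorthogonal (n := max m n + 1) (fun k _ => (hs k).1)
      (by omega) (by omega)
  · refine (TopologicalSpace.denseRange_denseSeq X).mono ?_
    rintro _ ⟨k, rfl⟩
    have h := (hs (4 * k)).2.2.1 (by omega)
    rw [show 4 * k / 4 = k by omega] at h
    refine Submodule.span_mono ?_ h
    rintro _ (rfl | ⟨i, -, rfl⟩) <;> exact Set.mem_range_self _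
  · refine hg v fun k => ?_
    have h := (hs (4 * k + 2)).2.2.2 (by omega)
    rw [show (4 * k + 2) / 4 = k by omega] at h
    have hle : Submodule.span ℂ (insert (s (4 * k + 2)).2
        ((fun i => (s i).2) '' Set.Iio (4 * k + 2))) ≤
        LinearMap.ker (ContinuousLinearMap.apply ℂ ℂ v : (X →L[ℂ] ℂ) →ₗ[ℂ] ℂ) := by
      refine Submodule.span_le.2 ?_
      rintro _ (rfl | ⟨i, -, rfl⟩)
      · exact hv _
      · exact hv _
    exact hle h
  · exact (hs (2 * n + 1)).2.1 (by omega)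

end Markushevich

/-! ### Orthogonal matrices and indexing of the blocks. -/

open scoped Matrix

/-- Haar-type orthogonal matrices: one column is uniformly small, and the remaining entries of each
row have bounded sum. -/
theorem exists_orthogonal_small_column (m : ℕ) :
    ∃ (J : Type) (_ : Fintype J) (_ : DecidableEq J) (j₀ : J) (A : Matrix J J ℝ),
      A * Aᵀ = 1 ∧ (0 < m → ∃ j, j ≠ j₀) ∧ (∀ k, |A k j₀| ≤ √(1 / 2) ^ m) ∧
      ∀ k, ∑ j, |A k j| ≤ |A k j₀| + 3 := by
  induction m with
  | zero =>
    refine ⟨Unit, inferInstance, inferInstance, (), 1, by simp, fun h => by omega, ?_, ?_⟩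
    · intro k; simp
    · intro k; simp
  | succ m ih =>
    obtain ⟨J, _, _, j₀, A, hA, -, hcol, hrow⟩ := ih
    have hsq : √(1 / 2) * √(1 / 2) = (1 / 2 : ℝ) := Real.mul_self_sqrt (by norm_num)
    have hs0 : 0 ≤ √(1 / 2 : ℝ) := Real.sqrt_nonneg _
    set r : ℝ := √(1 / 2) with hr
    -- The constant `3` survives the induction because one step sends an off-column row sum `S` to
    -- `r * (S + 1)`, and `r * (3 + 1) ≤ 3`.
    have hr34 : r ≤ 3 / 4 := by nlinarith
    let A' : Matrix (J ⊕ J) (J ⊕ J) ℝ := r • Matrix.fromBlocks A 1 A (-1)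
    have hrowsum : ∀ k, ∑ j, |A k j| * r + r ≤ |A k j₀| * r + 3 := fun k => by
      have := mul_le_mul_of_nonneg_right (hrow k) hs0
      rw [← Finset.sum_mul]
      nlinarith
    refine ⟨J ⊕ J, inferInstance, inferInstance, Sum.inl j₀, A', ?_,
      fun _ => ⟨Sum.inr j₀, by simp⟩, ?_, ?_⟩
    · simp only [A', Matrix.transpose_smul, Matrix.smul_mul, Matrix.mul_smul, smul_smul, hsq,
        Matrix.fromBlocks_transpose, Matrix.fromBlocks_multiply, hA]
      simp only [Matrix.transpose_one, Matrix.transpose_neg, mul_one, mul_neg, neg_neg,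
        add_neg_cancel]
      rw [Matrix.fromBlocks_smul, smul_zero, ← two_smul ℝ (1 : Matrix J J ℝ), smul_smul]
      norm_num
    · rintro (k | k)
      all_goals
        simp only [A', Matrix.smul_apply, Matrix.fromBlocks_apply₁₁, Matrix.fromBlocks_apply₂₁,
          smul_eq_mul, abs_mul, abs_of_nonneg hs0]
        rw [pow_succ']
        exact mul_le_mul_of_nonneg_left (hcol k) hs0
    · rintro (k | k)
      all_goals
        have h1 : ∑ j, |(1 : Matrix J J ℝ) k j| = 1 := by
          simp [Matrix.one_apply, apply_ite abs]
        simp only [Fintype.sum_sum_type, A', Matrix.smul_apply, Matrix.fromBlocks_apply₁₁,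
          Matrix.fromBlocks_apply₂₁, Matrix.fromBlocks_apply₁₂, Matrix.fromBlocks_apply₂₂,
          smul_eq_mul, abs_mul, abs_of_nonneg hs0, Matrix.neg_apply, abs_neg]
        rw [← Finset.mul_sum _ _ r, ← Finset.mul_sum _ _ r, h1]
        have := hrowsum k
        rw [← Finset.sum_mul] at this
        linarith

theorem exists_orthogonal_weighted_row_le (M : ℝ) :
    ∃ (J : Type) (_ : Fintype J) (_ : DecidableEq J) (j₀ : J) (A : Matrix J J ℝ),
      A * Aᵀ = 1 ∧ (∃ j, j ≠ j₀) ∧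
      ∀ k, |A k j₀| * M ≤ 1 ∧ ∑ j ∈ Finset.univ.erase j₀, |A k j| ≤ 3 := by
  have hlt : √(1 / 2 : ℝ) < 1 := by
    rw [Real.sqrt_lt' one_pos]; norm_num
  obtain ⟨m, hm⟩ := exists_pow_lt_of_lt_one (show 0 < 1 / (1 + |M|) by positivity) hlt
  -- Taking `m + 1` guarantees an index other than `j₀`.
  obtain ⟨J, _, _, j₀, A, hA, hne, hcol, hrow⟩ := exists_orthogonal_small_column (m + 1)
  refine ⟨J, inferInstance, inferInstance, j₀, A, hA, hne (Nat.succ_pos m), fun k => ⟨?_, ?_⟩⟩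
  · have h1 : |A k j₀| ≤ 1 / (1 + |M|) := (hcol k).trans <|
      (pow_le_pow_of_le_one (Real.sqrt_nonneg _) hlt.le (Nat.le_succ m)).trans hm.le
    rw [le_div_iff₀ (by positivity)] at h1
    nlinarith [le_abs_self M, abs_nonneg (A k j₀)]
  · have := hrow k
    rw [← Finset.add_sum_erase _ _ (Finset.mem_univ j₀)] at this
    linarith

/-- A bijection onto `ℕ` that sends the base points of a sequence of non-trivial finite types to
the even numbers. -/
theorem exists_bijective_sigma_nat {J : ℕ → Type} [∀ n, Fintype (J n)] (j₀ : ∀ n, J n)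
    (hne : ∀ n, ∃ j, j ≠ j₀ n) :
    ∃ φ : (Σ n, J n) → ℕ, Function.Bijective φ ∧ (∀ n, φ ⟨n, j₀ n⟩ = 2 * n) ∧
      ∀ n j, j ≠ j₀ n → ∃ i, φ ⟨n, j⟩ = 2 * i + 1 := by
  classical
  let G := Σ n, {j : J n // j ≠ j₀ n}
  choose j₁ hj₁ using hne
  have : Infinite G := Infinite.of_injective (fun n : ℕ => (⟨n, j₁ n, hj₁ n⟩ : G))
    fun a b h => congrArg Sigma.fst h
  obtain ⟨ψ⟩ : Nonempty (G ≃ ℕ) := nonempty_equiv_of_countable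
  let φ : (Σ n, J n) → ℕ := fun p =>
    if h : p.2 = j₀ p.1 then 2 * p.1 else 2 * ψ ⟨p.1, p.2, h⟩ + 1
  have h0 : ∀ n, φ ⟨n, j₀ n⟩ = 2 * n := fun n => dif_pos rfl
  have h1 : ∀ n j (h : j ≠ j₀ n), φ ⟨n, j⟩ = 2 * ψ ⟨n, j, h⟩ + 1 := fun n j h => dif_neg h
  refine ⟨φ, ⟨?_, ?_⟩, h0, fun n j h => ⟨_, h1 n j h⟩⟩
  · rintro ⟨n, j⟩ ⟨n', j'⟩ h
    by_cases hj : j = j₀ n <;> by_cases hj' : j' = j₀ n'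
    · subst hj hj'
      rw [h0, h0] at h
      obtain rfl : n = n' := by omega
      rfl
    · subst hj
      rw [h0, h1 _ _ hj'] at h
      omega
    · subst hj'
      rw [h0, h1 _ _ hj] at h
      omega
    · rw [h1 _ _ hj, h1 _ _ hj'] at h
      have h2 : (⟨n, j, hj⟩ : G) = ⟨n', j', hj'⟩ := ψ.injective (by omega)
      exact congrArg (fun p : G => (⟨p.1, p.2.1⟩ : Σ n, J n)) h2
  · intro i
    rcases Nat.even_or_odd' i with ⟨k, rfl | rfl⟩
    · exact ⟨⟨k, j₀ k⟩, h0 k⟩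
    · obtain ⟨⟨n, j, hj⟩, rfl⟩ := ψ.surjective k
      exact ⟨⟨n, j⟩, h1 n j hj⟩

/-! ### Mixing the blocks to obtain a bounded system. -/

section Bounded

variable {X : Type*} [NormedAddCommGroup X] [NormedSpace ℂ X]

/-- A biorthogonal system with countably infinite index set, fundamental, total and bounded, can be
normalized and arranged in a sequence. -/
theorem exists_isBoundedBiorthogonalSystem_of_equiv {ι : Type*} [DecidableEq ι] (e : ℕ ≃ ι)
    {y : ι → X} {g : ι → X →L[ℂ] ℂ} (hbi : ∀ p q, g p (y q) = if p = q then 1 else 0)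
    (hd : Dense (Submodule.span ℂ (Set.range y) : Set X)) (ht : ∀ v, (∀ p, g p v = 0) → v = 0)
    {C D : ℝ} (hy : ∀ p, ‖y p‖ ≤ C) (hg : ∀ p, ‖g p‖ ≤ D) :
    ∃ (x : ℕ → X) (f : ℕ → X →L[ℂ] ℂ), IsBoundedBiorthogonalSystem x f := by
  have hy0 : ∀ p, y p ≠ 0 := fun p h => by
    have := hbi p p
    simp [h] at this
  have hyn : ∀ p, (‖y p‖ : ℂ) ≠ 0 := fun p =>
    Complex.ofReal_ne_zero.2 (norm_ne_zero_iff.2 (hy0 p))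
  refine ⟨fun n => (‖y (e n)‖ : ℂ)⁻¹ • y (e n), fun n => (‖y (e n)‖ : ℂ) • g (e n), ?_, ?_, ?_, ?_,
    ?_⟩
  · intro m n
    simp only [smul_apply, map_smul, hbi, smul_eq_mul, e.injective.eq_iff]
    split_ifs with h
    · subst h
      rw [mul_one, inv_mul_cancel₀ (hyn _)]
    · simp
  · intro n
    rw [norm_smul, norm_inv, Complex.norm_real, norm_norm,
      inv_mul_cancel₀ (norm_ne_zero_iff.2 (hy0 _))]
  · refine ⟨C * D, fun n => ?_⟩
    rw [norm_smul, Complex.norm_real, norm_norm]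
    exact mul_le_mul (hy _) (hg _) (norm_nonneg _) ((norm_nonneg _).trans (hy (e n)))
  · refine hd.mono (Submodule.span_le.2 ?_ : Submodule.span ℂ (Set.range y) ≤ _)
    rintro _ ⟨p, rfl⟩
    have h := Submodule.smul_mem _ (‖y p‖ : ℂ) (Submodule.subset_span (R := ℂ)
      (Set.mem_range_self (f := fun n => (‖y (e n)‖ : ℂ)⁻¹ • y (e n)) (e.symm p)))
    simpa [smul_smul, hyn p] using h
  · intro v hv
    refine ht v fun p => ?_
    have h := hv (e.symm p)
    simpa [hy0 p] using h

theorem norm_sum_ofReal_smul_le {E : Type*} [NormedAddCommGroup E] [NormedSpace ℂ E] {J : Type*}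
    [Fintype J] [DecidableEq J] {j₀ : J} {a : J → ℝ} {z : J → E} {K : ℝ} (hK : 0 ≤ K)
    (h₀ : |a j₀| * ‖z j₀‖ ≤ 1) (ha : ∑ j ∈ Finset.univ.erase j₀, |a j| ≤ 3)
    (hz : ∀ j, j ≠ j₀ → ‖z j‖ ≤ K) : ‖∑ j, (a j : ℂ) • z j‖ ≤ 1 + 3 * K := by
  refine (norm_sum_le _ _).trans ?_
  simp only [norm_smul, Complex.norm_real, Real.norm_eq_abs]
  rw [← Finset.add_sum_erase _ _ (Finset.mem_univ j₀)]
  refine add_le_add h₀ ?_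
  calc ∑ j ∈ Finset.univ.erase j₀, |a j| * ‖z j‖ ≤ ∑ j ∈ Finset.univ.erase j₀, |a j| * K :=
        Finset.sum_le_sum fun j hj =>
          mul_le_mul_of_nonneg_left (hz j (Finset.ne_of_mem_erase hj)) (abs_nonneg _)
    _ = (∑ j ∈ Finset.univ.erase j₀, |a j|) * K := (Finset.sum_mul _ _ _).symm
    _ ≤ 3 * K := mul_le_mul_of_nonneg_right ha hK

/-- An orthogonal change of basis is inverted by the transposed matrix. -/
theorem sum_smul_sum_smul_of_transpose_mul_self {E : Type*} [AddCommGroup E] [Module ℂ E]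
    {J : Type*} [Fintype J] [DecidableEq J] {A : Matrix J J ℝ} (hA : Aᵀ * A = 1) (z : J → E)
    (j : J) : ∑ k, (A k j : ℂ) • ∑ i, (A k i : ℂ) • z i = z j := by
  simp only [Finset.smul_sum, smul_smul]
  rw [Finset.sum_comm]
  simp only [← Finset.sum_smul]
  have h : ∀ i, ∑ k, (A k j : ℂ) * (A k i : ℂ) = if j = i then 1 else 0 := fun i => by
    have := congrFun (congrFun hA j) i
    simp only [Matrix.mul_apply, Matrix.transpose_apply, Matrix.one_apply] at this
    have h2 := congrArg (fun r : ℝ => (r : ℂ)) this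
    rw [Complex.ofReal_sum] at h2
    simpa only [Complex.ofReal_mul, apply_ite Complex.ofReal, Complex.ofReal_one,
      Complex.ofReal_zero] using h2
  simp [h]

/-- The Ovsepian-Pełczyński theorem: a separable infinite-dimensional space has a bounded
fundamental total biorthogonal sequence. -/
theorem exists_isBoundedBiorthogonalSystem [TopologicalSpace.SeparableSpace X]
    (hX : ¬ FiniteDimensional ℂ X) :
    ∃ (x : ℕ → X) (f : ℕ → X →L[ℂ] ℂ), IsBoundedBiorthogonalSystem x f := by
  classical
  obtain ⟨x, f, hbi, hd, ht, hodd⟩ := exists_biorthogonal_odd_bounded hX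
  -- The maximum lets one real matrix per block tame both the vector and the functional of even
  -- index.
  choose J _ _ j₀ A hA hne hrow using fun n =>
    exists_orthogonal_weighted_row_le (max ‖x (2 * n)‖ ‖f (2 * n)‖)
  obtain ⟨φ, hφ, hφ0, hφ1⟩ := exists_bijective_sigma_nat j₀ hne
  have hAt : ∀ n, (A n)ᵀ * A n = 1 := fun n => mul_eq_one_comm.1 (hA n)
  let y : (Σ n, J n) → X := fun p => ∑ j, (A p.1 p.2 j : ℂ) • x (φ ⟨p.1, j⟩)
  let g : (Σ n, J n) → X →L[ℂ] ℂ := fun p => ∑ j, (A p.1 p.2 j : ℂ) • f (φ ⟨p.1, j⟩)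
  -- The even term contributes at most `1`; the rest have coefficient sum at most `3` against norms
  -- at most `1` (vectors) or `3` (functionals).
  refine exists_isBoundedBiorthogonalSystem_of_equiv (Equiv.ofBijective φ hφ).symm (y := y)
    (g := g) (C := 1 + 3 * 1) (D := 1 + 3 * 3) ?_ ?_ ?_ ?_ ?_
  · rintro ⟨n, k⟩ ⟨n', k'⟩
    simp only [y, g, sum_apply, smul_apply, map_sum,
      map_smul, hbi, hφ.injective.eq_iff, smul_eq_mul]
    by_cases hn : n = n'
    · subst hn
      have h := congrFun (congrFun (hA n) k) k'
      simp only [Matrix.mul_apply, Matrix.transpose_apply, Matrix.one_apply] at h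
      have h2 := congrArg (fun r : ℝ => (r : ℂ)) h
      rw [Complex.ofReal_sum] at h2
      simpa [apply_ite Complex.ofReal, mul_comm] using h2
    · simp [hn]
  · refine hd.mono (Submodule.span_le.2 ?_ : Submodule.span ℂ (Set.range x) ≤ _)
    rintro _ ⟨i, rfl⟩
    obtain ⟨⟨n, j⟩, rfl⟩ := hφ.surjective i
    rw [← sum_smul_sum_smul_of_transpose_mul_self (hAt n) (fun j => x (φ ⟨n, j⟩)) j]
    exact Submodule.sum_mem _ fun k _ => Submodule.smul_mem _ _
      (Submodule.subset_span ⟨⟨n, k⟩, rfl⟩)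
  · intro v hv
    refine ht v fun i => ?_
    obtain ⟨⟨n, j⟩, rfl⟩ := hφ.surjective i
    rw [← sum_smul_sum_smul_of_transpose_mul_self (hAt n) (fun j => f (φ ⟨n, j⟩)) j,
      sum_apply]
    refine Finset.sum_eq_zero fun k _ => ?_
    have h := hv ⟨n, k⟩
    rw [smul_apply]
    exact (congrArg _ h).trans (smul_zero _)
  · rintro ⟨n, k⟩
    refine norm_sum_ofReal_smul_le (j₀ := j₀ n) zero_le_one ?_ (hrow n k).2 fun j hj => ?_
    · rw [hφ0]
      exact (mul_le_mul_of_nonneg_left (le_max_left _ _) (abs_nonneg _)).trans (hrow n k).1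
    · obtain ⟨i, hi⟩ := hφ1 n j hj
      rw [hi]
      exact (hodd i).1.le
  · rintro ⟨n, k⟩
    refine norm_sum_ofReal_smul_le (j₀ := j₀ n) (by norm_num) ?_ (hrow n k).2 fun j hj => ?_
    · rw [hφ0]
      exact (mul_le_mul_of_nonneg_left (le_max_right _ _) (abs_nonneg _)).trans (hrow n k).1
    · obtain ⟨i, hi⟩ := hφ1 n j hj
      rw [hi]
      exact (hodd i).2

end Bounded

theorem theorem4p5 {X : Type*} [NormedAddCommGroup X] [NormedSpace ℂ X] [CompleteSpace X]
    [TopologicalSpace.SeparableSpace X] (hX : ¬ FiniteDimensional ℂ X)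
    (Γ : Set ℂ) (hΓ : ¬ Bornology.IsBounded Γ)
    (F : Set (Set ℕ)) (hF : IsHypercyclicitySet F) :
    (∃ T : X →L[ℂ] X, IsHypercyclicOperator F Γ T) ∧
    (∃ (x : ℕ → X) (f : ℕ → X →L[ℂ] ℂ), IsBoundedBiorthogonalSystem x f) ∧
    (∀ (x : ℕ → X) (f : ℕ → X →L[ℂ] ℂ), IsBoundedBiorthogonalSystem x f →
      ∀ u : ℕ → ℝ, (∀ n, 0 < u n) → Summable u →
        ∃ T : X →L[ℂ] X,
          (∀ v : X, HasSum (fun n => (f (n + 1) v * (u n : ℂ)) • x n) (T v)) ∧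
          IsHypercyclicOperator F Γ T) := by
  have hex := exists_isBoundedBiorthogonalSystem hX
  have hshift : ∀ (x : ℕ → X) (f : ℕ → X →L[ℂ] ℂ), IsBoundedBiorthogonalSystem x f →
      ∀ u : ℕ → ℝ, (∀ n, 0 < u n) → Summable u →
        ∃ T : X →L[ℂ] X,
          (∀ v : X, HasSum (fun n => (f (n + 1) v * (u n : ℂ)) • x n) (T v)) ∧
          IsHypercyclicOperator F Γ T := by
    intro x f hxf u hu hs
    obtain ⟨C, hC⟩ := hxf.bounded
    obtain ⟨T, hT⟩ := exists_weightedBackwardShift hxf.norm_eq_one hC hu hs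
    exact ⟨T, hT, isHypercyclicOperator_weightedBackwardShift hΓ hF hxf.biorthogonal
      hxf.dense_span hu hT⟩
  refine ⟨?_, hex, hshift⟩
  obtain ⟨x, f, hxf⟩ := hex
  obtain ⟨T, -, hT⟩ := hshift x f hxf (fun n => (1 / 2) ^ n) (fun n => by positivity)
    summable_geometric_two
  exact ⟨T, hT⟩
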